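/- Let $n \ge 0$ be an integer and let $\varphi \in L^2(\mathbb{R}^n)$ be complex valued with $\|\varphi\|_2 = 1$. Let $\hat\varphi$ denote its unitary Fourier transform (the isometric extension to $L^2$ of $\hat\varphi(k) = (2\pi)^{-n/2}\int \varphi(x) e^{-i\langle k,x\rangle}\,dx$). Put $d\nu_\varphi = |\varphi(x)|^2\,dx$ and $d\nu_{\hat\varphi} = |\hat\varphi(k)|^2\,dk$, and let $\Gamma(\varphi)$ be the set of Borel probability measures on $\mathbb{R}^n\times\mathbb{R}^n$ with first marginal $\nu_\varphi$ and second marginal $\nu_{\hat\varphi}$. Let $H:\mathbb{R}^n\times\mathbb{R}^n\to\mathbb{R}$ be lower semicontinuous and bounded below. Define, with values in $(-\infty,+\infty]$, the Kantorovich, Monge and Schrödinger energies of $\varphi$ by $$K_H(\varphi)=\inf_{\gamma\in\Gamma(\varphi)}\int H\,d\gamma,\qquad M_H(\varphi)=\inf\Big\{\int H(q,S(q))\,d\nu_\varphi(q)\;:\;S:\mathbb{R}^n\to\mathbb{R}^n\text{ Borel},\ S_\#\nu_\varphi=\nu_{\hat\varphi}\Big\},\qquad E_H(\varphi)=\int H\,d(\nu_\varphi\otimes\nu_{\hat\varphi}).$$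 Suppose that $H(q,p)=T(p)+V(q)$ for all $q,p$, with functions $T,V:\mathbb{R}^n\to\mathbb{R}$. Then $$K_H(\varphi)=M_H(\varphi)=E_H(\varphi)=\int T\,d\nu_{\hat\varphi}+\int V\,d\nu_\varphi .$$ In particular, the product plan $\nu_\varphi\otimes\nu_{\hat\varphi}$ belongs to $\Gamma(\varphi)$ and is optimal: $\int H\,d(\nu_\varphi\otimes\nu_{\hat\varphi})\le\int H\,d\gamma$ for every $\gamma\in\Gamma(\varphi)$. -/

import Mathlib

open MeasureTheory Set
open scoped FourierTransform ENNReal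

noncomputable section

namespace PhaseSpaceTransport

/-- Configuration (or momentum) space `ℝⁿ` with its Euclidean structure. -/
abbrev Space (n : ℕ) : Type := EuclideanSpace ℝ (Fin n)

/-- The complex Hilbert space `L²(ℝⁿ)`. -/
abbrev WaveFun (n : ℕ) : Type := Lp ℂ 2 (volume : Measure (Space n))

/-- The unitary Fourier transform
`φ̂(k) = (2π)^(-n/2) ∫ φ(x) e^{-i⟨k,x⟩} dx` on `L²(ℝⁿ)`, as a function defined almost everywhere.
Mathlib's `L²` transform is the isometric extension of `∫ φ(x) e^{-2πi⟨k,x⟩} dx`, so it is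
rescaled here. -/
def unitaryFourier {n : ℕ} (φ : WaveFun n) : Space n → ℂ := fun k =>
  (((2 * Real.pi) ^ (-(n : ℝ) / 2) : ℝ) : ℂ) *
    (𝓕 φ : WaveFun n) ((2 * Real.pi)⁻¹ • k)

/-- The measure `|f(x)|² dx` on `ℝⁿ`. -/
def densityMeasure {n : ℕ} (f : Space n → ℂ) : Measure (Space n) :=
  (volume : Measure (Space n)).withDensity fun x => ‖f x‖ₑ ^ 2

/-- The position distribution `ν_φ = |φ(x)|² dx`. -/
def posMeasure {n : ℕ} (φ : WaveFun n) : Measure (Space n) :=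
  densityMeasure φ

/-- The momentum distribution `ν_φ̂ = |φ̂(k)|² dk`. -/
def momMeasure {n : ℕ} (φ : WaveFun n) : Measure (Space n) :=
  densityMeasure (unitaryFourier φ)

/-- The product plan `μ_φ = ν_φ ⊗ ν_φ̂` on phase space. -/
def productPlan {n : ℕ} (φ : WaveFun n) : Measure (Space n × Space n) :=
  (posMeasure φ).prod (momMeasure φ)

/-- `Γ(φ)`: the probability measures on phase space with marginals `ν_φ` and `ν_φ̂`. -/
def plans {n : ℕ} (φ : WaveFun n) : Set (Measure (Space n × Space n)) :=
  {γ | IsProbabilityMeasure γ ∧ γ.map Prod.fst = posMeasure φ ∧ γ.map Prod.snd = momMeasure φ}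

/-- The transport maps from `ν_φ` to `ν_φ̂`: Borel maps `T` with `T_# ν_φ = ν_φ̂`. -/
def transportMaps {n : ℕ} (φ : WaveFun n) : Set (Space n → Space n) :=
  {T | Measurable T ∧ (posMeasure φ).map T = momMeasure φ}

/-- The integral `∫ f dμ = ∫ f⁺ dμ - ∫ f⁻ dμ` with values in `[-∞, ∞]`. For a finite measure and a
measurable `f` that is bounded below, `∫ f⁻ dμ` is finite, so this is the usual integral with values
in `(-∞, ∞]`. -/
def extIntegral {α : Type*} [MeasurableSpace α] (μ : Measure α) (f : α → ℝ) : EReal :=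
  ((∫⁻ x, ENNReal.ofReal (f x) ∂μ : ℝ≥0∞) : EReal) -
    ((∫⁻ x, ENNReal.ofReal (-f x) ∂μ : ℝ≥0∞) : EReal)

/-- The Kantorovich energy `K_H(φ) = inf_{γ ∈ Γ(φ)} ∫ H dγ`. -/
def kantorovichEnergy {n : ℕ} (H : Space n × Space n → ℝ) (φ : WaveFun n) : EReal :=
  ⨅ γ ∈ plans φ, extIntegral γ H

/-- The Schrödinger energy `E_H(φ) = ∫ H dμ_φ`. -/
def schrodingerEnergy {n : ℕ} (H : Space n × Space n → ℝ) (φ : WaveFun n) : EReal :=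
  extIntegral (productPlan φ) H

/-- The Monge energy `M_H(φ) = inf {∫ H(q, T q) dν_φ(q) : T_# ν_φ = ν_φ̂}`. -/
def mongeEnergy {n : ℕ} (H : Space n × Space n → ℝ) (φ : WaveFun n) : EReal :=
  ⨅ T ∈ transportMaps φ, extIntegral (posMeasure φ) fun q => H (q, T q)

end PhaseSpaceTransport

end

open PhaseSpaceTransport

/-!
For a separable cost `H (q, p) = T p + V q` the transport cost of a plan depends on its marginals
only: integration against `γ` gives `∫ T dν_φ̂ + ∫ V dν_φ` for every `γ ∈ Γ(φ)`
(`extIntegral_eq_of_mem_plans`). Here the section `T = H (0, ·) - V 0` and, likewise, `V` inherit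
measurability and a lower bound from `H`, so that the integrals are additive with values in
`(-∞, ∞]` (`extIntegral_add`). All three energies are therefore equal as soon as the infima are
taken over nonempty sets.

The product plan is admissible because both marginals are probability measures, which for
`ν_φ̂` is Plancherel's theorem with a change of variables. A transport map exists because `ν_φ` is
absolutely continuous, hence atomless when `n ≥ 1`: a Borel embedding into `ℝ` followed by the
distribution function sends an atomless law to the uniform law on `[0, 1]`
(`exists_measurable_map_eq_volume`), and the uniform law on `[0, 1]` can be sent to any law on a
standard Borel space. For `n = 0` the space is a point, and the identity is a transport map.
-/

namespace PhaseSpaceTransport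

open ProbabilityTheory Filter Topology

/-! ### Extended integrals of functions bounded below -/

section ExtIntegral

variable {α β : Type*} [MeasurableSpace α] [MeasurableSpace β]

lemma lintegral_neg_part_ne_top {μ : Measure α} [IsFiniteMeasure μ] {f : α → ℝ}
    (hb : BddBelow (Set.range f)) : ∫⁻ x, ENNReal.ofReal (-f x) ∂μ ≠ ∞ := by
  obtain ⟨c, hc⟩ := hb
  have hle : ∫⁻ x, ENNReal.ofReal (-f x) ∂μ ≤ ∫⁻ _, ENNReal.ofReal (-c) ∂μ :=
    lintegral_mono fun x => ENNReal.ofReal_le_ofReal (neg_le_neg (hc ⟨x, rfl⟩))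
  refine ne_top_of_le_ne_top ?_ hle
  rw [lintegral_const]
  exact ENNReal.mul_ne_top ENNReal.ofReal_ne_top (measure_ne_top μ _)

lemma ereal_coe_sub_add_sub {A B C a b c : ℝ≥0∞} (ha : a ≠ ∞) (hb : b ≠ ∞) (hc : c ≠ ∞)
    (h : A + B + c = C + a + b) :
    (C : EReal) - c = ((A : EReal) - a) + ((B : EReal) - b) := by
  lift a to NNReal using ha
  lift b to NNReal using hb
  lift c to NNReal using hc
  induction A with
  | top =>
    have hC : C = ∞ := by simpa [eq_comm] using h
    subst hC
    induction B <;> rfl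
  | coe A =>
    induction B with
    | top =>
      have hC : C = ∞ := by simpa [eq_comm] using h
      subst hC
      rfl
    | coe B =>
      induction C with
      | top => simp [← ENNReal.coe_add] at h
      | coe C =>
        have h' : (A : ℝ) + B + c = C + a + b := by exact_mod_cast h
        have h'' : (C : ℝ) - c = (A - a) + (B - b) := by linarith
        change ((C : ℝ) : EReal) - (c : ℝ) = ((A : ℝ) - (a : ℝ)) + ((B : ℝ) - (b : ℝ))
        exact_mod_cast h''

lemma extIntegral_add {μ : Measure α} [IsFiniteMeasure μ] {f g : α → ℝ}
    (hf : Measurable f) (hg : Measurable g)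
    (hfb : BddBelow (Set.range f)) (hgb : BddBelow (Set.range g)) :
    extIntegral μ (fun x => f x + g x) = extIntegral μ f + extIntegral μ g := by
  have hfgb : BddBelow (Set.range fun x => f x + g x) := hfb.range_add hgb
  refine ereal_coe_sub_add_sub (lintegral_neg_part_ne_top hfb) (lintegral_neg_part_ne_top hgb)
    (lintegral_neg_part_ne_top hfgb) ?_
  rw [← lintegral_add_left (by fun_prop), ← lintegral_add_left (by fun_prop),
    ← lintegral_add_left (by fun_prop), ← lintegral_add_left (by fun_prop)]
  -- Pointwise this is `f⁺ + g⁺ + (f + g)⁻ = (f + g)⁺ + f⁻ + g⁻`.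
  refine lintegral_congr fun x => ?_
  simp only [ENNReal.ofReal, ← ENNReal.coe_add, ENNReal.coe_inj]
  apply NNReal.eq
  simp only [NNReal.coe_add, Real.coe_toNNReal']
  grind

lemma extIntegral_map {μ : Measure α} {g : α → β} (hg : Measurable g) {f : β → ℝ}
    (hf : Measurable f) : extIntegral (μ.map g) f = extIntegral μ fun x => f (g x) := by
  unfold extIntegral
  rw [lintegral_map (by fun_prop) hg, lintegral_map (by fun_prop) hg]

end ExtIntegral

/-! ### Transport of atomless measures -/

lemma continuous_cdf (μ : Measure ℝ) [IsProbabilityMeasure μ] [NullSingletonClass μ] :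
    Continuous (cdf μ) := by
  refine continuous_iff_continuousAt.2 fun x => ?_
  rw [(monotone_cdf μ).continuousAt_iff_leftLim_eq_rightLim, StieltjesFunction.rightLim_eq]
  have h : (cdf μ).measure {x} = 0 := by rw [measure_cdf]; exact measure_singleton x
  rw [StieltjesFunction.measure_singleton, ENNReal.ofReal_eq_zero] at h
  exact le_antisymm ((monotone_cdf μ).leftLim_le le_rfl) (by linarith)

/-- The distribution function of an atomless law is itself uniformly distributed. -/
lemma measure_cdf_le (μ : Measure ℝ) [IsProbabilityMeasure μ] [NullSingletonClass μ] {t : ℝ}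
    (ht : t ∈ Set.Icc (0 : ℝ) 1) : μ {x | cdf μ x ≤ t} = ENNReal.ofReal t := by
  have surj : ∀ s ∈ Set.Ioo (0 : ℝ) 1, ∃ x, cdf μ x = s := fun s hs =>
    mem_range_of_exists_le_of_exists_ge (continuous_cdf μ)
      (((tendsto_cdf_atBot μ).eventually_le_const hs.1).exists)
      (((tendsto_cdf_atTop μ).eventually_const_le hs.2).exists)
  rcases ht.2.eq_or_lt with rfl | ht1
  · simp [cdf_le_one]
  apply le_antisymm
  · -- The set lies below a point of level `s`, for each `s ∈ (t, 1)`.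
    have key : ∀ s ∈ Set.Ioo t 1, μ.real {x | cdf μ x ≤ t} ≤ s := by
      intro s hs
      obtain ⟨x, hx⟩ := surj s ⟨ht.1.trans_lt hs.1, hs.2⟩
      rw [← hx, cdf_eq_real]
      refine measureReal_mono fun y hy => ?_
      by_contra hxy
      have := monotone_cdf μ (not_le.1 hxy).le
      have hy' : cdf μ y ≤ t := hy
      linarith [hs.1]
    rw [← ofReal_measureReal]
    refine ENNReal.ofReal_le_ofReal (le_of_forall_gt_imp_ge_of_dense fun s hs => ?_)
    rcases lt_or_ge s 1 with h1 | h1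
    · exact key s ⟨hs, h1⟩
    · exact measureReal_le_one.trans h1
  · rcases ht.1.eq_or_lt with rfl | ht0
    · simp
    obtain ⟨x, hx⟩ := surj t ⟨ht0, ht1⟩
    rw [← hx, ofReal_cdf]
    exact measure_mono fun y hy => monotone_cdf μ hy

lemma exists_measurable_map_eq_volume {α : Type*} [MeasurableSpace α] [StandardBorelSpace α]
    (μ : Measure α) [IsProbabilityMeasure μ] [NullSingletonClass μ] :
    ∃ f : α → unitInterval, Measurable f ∧ μ.map f = volume := by
  have he := measurableEmbedding_embeddingReal α
  set ν : Measure ℝ := μ.map (embeddingReal α) with hν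
  have : IsProbabilityMeasure ν := Measure.isProbabilityMeasure_map he.measurable.aemeasurable
  have : NullSingletonClass ν := ⟨fun x => by
    rw [hν, he.map_apply]
    exact (Set.subsingleton_singleton.preimage he.injective).measure_zero μ⟩
  let F : ℝ → unitInterval := fun x => ⟨cdf ν x, cdf_nonneg ν x, cdf_le_one ν x⟩
  have hF : Measurable F := ((monotone_cdf ν).measurable).subtype_mk
  refine ⟨F ∘ embeddingReal α, hF.comp he.measurable, ?_⟩
  rw [← Measure.map_map hF he.measurable, ← hν]
  have : IsProbabilityMeasure (ν.map F) := Measure.isProbabilityMeasure_map hF.aemeasurable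
  refine Measure.ext_of_Iic _ _ fun t => ?_
  rw [Measure.map_apply hF measurableSet_Iic, unitInterval.volume_Iic]
  exact measure_cdf_le ν t.2

theorem exists_measurable_map_eq_of_nullSingletonClass {α β : Type*} [MeasurableSpace α]
    [StandardBorelSpace α] [MeasurableSpace β] [StandardBorelSpace β]
    (μ : Measure α) [IsProbabilityMeasure μ] [NullSingletonClass μ] (ν : Measure β) [IsProbabilityMeasure ν] :
    ∃ f : α → β, Measurable f ∧ μ.map f = ν := by
  have : Nonempty β := nonempty_of_isProbabilityMeasure ν
  obtain ⟨f, hf, hfμ⟩ := exists_measurable_map_eq_volume μ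
  obtain ⟨g, hg, hgν⟩ := Measure.exists_measurable_map_eq ν
  exact ⟨g ∘ f, hg.comp hf, by rw [← Measure.map_map hg hf, hfμ, hgν]⟩

/-! ### The position and momentum distributions -/

lemma lintegral_enorm_sq_eq_one {n : ℕ} {f : WaveFun n} (hf : ‖f‖ = 1) :
    ∫⁻ x, ‖f x‖ₑ ^ 2 = 1 := by
  have h : eLpNorm f 2 volume = 1 := by
    rw [← Lp.enorm_def, ← ofReal_norm, hf, ENNReal.ofReal_one]
  have h2 := eLpNorm_nnreal_pow_eq_lintegral (f := f) (μ := volume) (p := 2) two_ne_zero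
  simpa [h] using h2.symm

lemma isProbabilityMeasure_posMeasure {n : ℕ} {φ : WaveFun n} (hφ : ‖φ‖ = 1) :
    IsProbabilityMeasure (posMeasure φ) :=
  ⟨by simpa [posMeasure, densityMeasure] using lintegral_enorm_sq_eq_one hφ⟩

/-- Plancherel's theorem in the unitary normalization; the Jacobian `(2π)ⁿ` of `k ↦ k / 2π` cancels
the square of the prefactor `(2π)^(-n/2)`. -/
lemma isProbabilityMeasure_momMeasure {n : ℕ} {φ : WaveFun n} (hφ : ‖φ‖ = 1) :
    IsProbabilityMeasure (momMeasure φ) := by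
  have hpi : (0 : ℝ) < 2 * Real.pi := by positivity
  set g : WaveFun n := 𝓕 φ with hg
  have hg1 : ∫⁻ x, ‖g x‖ₑ ^ 2 = 1 :=
    lintegral_enorm_sq_eq_one (by rw [hg, Lp.norm_fourier_eq, hφ])
  have hgm : Measurable fun x => ‖g x‖ₑ ^ 2 :=
    (Lp.stronglyMeasurable g).measurable.enorm.pow_const 2
  have hscale : ∫⁻ k, ‖g ((2 * Real.pi)⁻¹ • k)‖ₑ ^ 2 = ENNReal.ofReal ((2 * Real.pi) ^ n) := by
    rw [← lintegral_map (μ := volume) (g := fun k : Space n => (2 * Real.pi)⁻¹ • k) hgm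
        (measurable_const_smul _),
      Measure.map_addHaar_smul volume (inv_ne_zero hpi.ne'), lintegral_smul_measure, hg1, finrank_euclideanSpace_fin, inv_pow, inv_inv,
      abs_of_pos (pow_pos hpi n), smul_eq_mul, mul_one]
  refine ⟨?_⟩
  rw [momMeasure, densityMeasure, withDensity_apply _ MeasurableSet.univ, Measure.restrict_univ]
  simp only [unitaryFourier, enorm_mul, mul_pow, ← hg]
  have hgm' : Measurable fun k : Space n => ‖g ((2 * Real.pi)⁻¹ • k)‖ₑ ^ 2 :=
    hgm.comp (measurable_const_smul _)
  rw [lintegral_const_mul _ hgm', hscale, ← ofReal_norm, Complex.norm_real, Real.norm_of_nonneg (by positivity),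
    ← ENNReal.ofReal_pow (by positivity), ← ENNReal.ofReal_mul (by positivity),
    ← Real.rpow_natCast, ← Real.rpow_mul hpi.le, ← Real.rpow_natCast, ← Real.rpow_add hpi]
  simp

lemma transportMaps_nonempty {n : ℕ} {φ : WaveFun n} (hφ : ‖φ‖ = 1) :
    (transportMaps φ).Nonempty := by
  have := isProbabilityMeasure_posMeasure hφ
  have := isProbabilityMeasure_momMeasure hφ
  rcases Nat.eq_zero_or_pos n with rfl | hn
  · refine ⟨id, measurable_id, ?_⟩
    rw [Measure.map_id]
    ext s
    rcases s.eq_empty_or_nonempty with rfl | h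
    · simp
    · simp [Subsingleton.eq_univ_of_nonempty h]
  · have : Nonempty (Fin n) := ⟨⟨0, hn⟩⟩
    have : NullSingletonClass (posMeasure φ) :=
      ⟨fun x => withDensity_absolutelyContinuous _ _ (measure_singleton x)⟩
    exact exists_measurable_map_eq_of_nullSingletonClass (posMeasure φ) (momMeasure φ)

/-! ### Separable costs -/

lemma productPlan_mem_plans {n : ℕ} {φ : WaveFun n} (hφ : ‖φ‖ = 1) :
    productPlan φ ∈ plans φ := by
  have := isProbabilityMeasure_posMeasure hφ
  have := isProbabilityMeasure_momMeasure hφ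
  refine ⟨?_, ?_, ?_⟩
  · unfold productPlan; infer_instance
  · simp [productPlan, Measure.map_fst_prod]
  · simp [productPlan, Measure.map_snd_prod]

/-- The graph of a transport map carries a plan. -/
lemma map_graph_mem_plans {n : ℕ} {φ : WaveFun n} (hφ : ‖φ‖ = 1) {S : Space n → Space n}
    (hS : S ∈ transportMaps φ) : (posMeasure φ).map (fun q => (q, S q)) ∈ plans φ := by
  have := isProbabilityMeasure_posMeasure hφ
  obtain ⟨hSm, hSmap⟩ := hS
  have hm : Measurable fun q => (q, S q) := measurable_id.prodMk hSm
  refine ⟨Measure.isProbabilityMeasure_map hm.aemeasurable, ?_, ?_⟩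
  · rw [Measure.map_map measurable_fst hm]
    exact Measure.map_id
  · rw [Measure.map_map measurable_snd hm]
    exact hSmap

/-- The cost of a plan depends on its marginals only. -/
lemma extIntegral_eq_of_mem_plans {n : ℕ} {H : Space n × Space n → ℝ} (hH : Measurable H)
    (hbdd : BddBelow (Set.range H)) {T V : Space n → ℝ} (hsep : ∀ q p, H (q, p) = T p + V q)
    {φ : WaveFun n} {γ : Measure (Space n × Space n)} (hγ : γ ∈ plans φ) :
    extIntegral γ H = extIntegral (momMeasure φ) T + extIntegral (posMeasure φ) V := by
  obtain ⟨hγ1, hfst, hsnd⟩ := hγ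
  obtain ⟨c, hc⟩ := hbdd
  have hTeq : T = fun p => H (0, p) - V 0 := by ext p; rw [hsep]; ring
  have hVeq : V = fun q => H (q, 0) - T 0 := by ext q; rw [hsep]; ring
  have hT : Measurable T := by
    rw [hTeq]
    exact (hH.comp measurable_prodMk_left).sub_const _
  have hV : Measurable V := by
    rw [hVeq]
    exact (hH.comp measurable_prodMk_right).sub_const _
  have hTb : ∀ p, c - V 0 ≤ T p := fun p => by linarith [hc ⟨(0, p), rfl⟩, hsep 0 p]
  have hVb : ∀ q, c - T 0 ≤ V q := fun q => by linarith [hc ⟨(q, 0), rfl⟩, hsep q 0]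
  have hHeq : H = fun z => T z.2 + V z.1 := funext fun z => hsep z.1 z.2
  rw [hHeq, extIntegral_add (f := fun z : Space n × Space n => T z.2)
    (g := fun z : Space n × Space n => V z.1)
    (hT.comp measurable_snd) (hV.comp measurable_fst)
    ⟨c - V 0, Set.forall_mem_range.2 fun z => hTb z.2⟩
    ⟨c - T 0, Set.forall_mem_range.2 fun z => hVb z.1⟩,
    ← hfst, ← hsnd, extIntegral_map measurable_snd hT, extIntegral_map measurable_fst hV]

end PhaseSpaceTransport

theorem mainTheorem6 (n : ℕ)
    (H : Space n × Space n → ℝ) (hlsc : LowerSemicontinuous H) (hbdd : BddBelow (Set.range H))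
    (T V : Space n → ℝ) (hsep : ∀ q p, H (q, p) = T p + V q)
    (φ : WaveFun n) (hφ : ‖φ‖ = 1) :
    kantorovichEnergy H φ = schrodingerEnergy H φ ∧
    mongeEnergy H φ = schrodingerEnergy H φ ∧
    schrodingerEnergy H φ = extIntegral (momMeasure φ) T + extIntegral (posMeasure φ) V ∧
    productPlan φ ∈ plans φ ∧
    ∀ γ ∈ plans φ, extIntegral (productPlan φ) H ≤ extIntegral γ H := by
  have hH : Measurable H := hlsc.measurable
  have hprod := productPlan_mem_plans hφ
  have hplan : ∀ γ ∈ plans φ, extIntegral γ H = schrodingerEnergy H φ := fun γ hγ => by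
    rw [schrodingerEnergy, extIntegral_eq_of_mem_plans hH hbdd hsep hγ,
      extIntegral_eq_of_mem_plans hH hbdd hsep hprod]
  have hmap : ∀ S ∈ transportMaps φ,
      extIntegral (posMeasure φ) (fun q => H (q, S q)) = schrodingerEnergy H φ := fun S hS => by
    rw [← hplan _ (map_graph_mem_plans hφ hS), extIntegral_map (g := fun q => (q, S q)) (measurable_id.prodMk hS.1) hH]
  refine ⟨?_, ?_, extIntegral_eq_of_mem_plans hH hbdd hsep hprod, hprod,
    fun γ hγ => (hplan γ hγ).ge⟩
  · rw [kantorovichEnergy, biInf_congr hplan]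
    exact biInf_const ⟨_, hprod⟩
  · rw [mongeEnergy, biInf_congr hmap]
    exact biInf_const (transportMaps_nonempty hφ)
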